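/- For a set $F$ of 0--1 matrices, let $\operatorname{Ex}(F,n,m)$ be the maximum number of 1s in an $n\times m$ 0--1 matrix $A$ ($n$ rows, $m$ columns) that contains no $P\in F$; here a $k\times l$ matrix $P$ is contained in $A$ if there are rows $r_1<\cdots<r_k$ and columns $c_1<\cdots<c_l$ of $A$ such that $P(i,j)=1$ implies $A(r_i,c_j)=1$. Let $$W=\begin{pmatrix}1&0&0&0&0\\0&0&0&0&1\\0&0&1&0&0\\0&1&0&1&0\end{pmatrix},\qquad W'=\begin{pmatrix}0&0&0&0&1\\1&0&0&0&0\\0&0&1&0&0\\0&1&0&1&0\end{pmatrix},$$ so that $W'$ is the reflection of $W$ along the $y$-axis. Let $a_{1,j}=2^j$ for $j\ge 1$, $a_{i,1}=2$ for $i\ge 2$, and $a_{i,j}=w\cdot a_{i-1,w}$ with $w=a_{i,j-1}$ for $i,j\ge 2$. For $n,m\ge 1$ let $\alpha(n,m)=\min\{i\ge 1 : a_{i,j}\ge m\}$, where $j=\max\{3,\lceil n/m\rceil\}$. Theorem. There is an absolute constant $C$ such that, for all integers $n,m\ge 1$, $$\operatorname{Ex}(\{W,W'\},n,m)\le 4n\,\alpha(n,m)+C(n+m).$$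 -/

import Mathlib

/-- 0--1 matrices with `n` rows (listed from top to bottom) and `m` columns
(listed from left to right). -/
abbrev ZeroOneMatrix (n m : ℕ) : Type := Matrix (Fin n) (Fin m) (Fin 2)

namespace ZeroOneMatrix

/-- The weight `‖A‖₁` of a 0--1 matrix: its number of 1s. -/
def weight {n m : ℕ} (A : ZeroOneMatrix n m) : ℕ :=
  (Finset.univ.filter fun p : Fin n × Fin m => A p.1 p.2 = 1).card

/-- `P ≺ A`: there are rows `r₁ < ⋯ < r_k` and columns `c₁ < ⋯ < c_l` of `A` such that
`P i j = 1` implies `A (r i) (c j) = 1`. -/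
def IsContainedIn {k l n m : ℕ} (P : ZeroOneMatrix k l) (A : ZeroOneMatrix n m) : Prop :=
  ∃ (r : Fin k → Fin n) (c : Fin l → Fin m), StrictMono r ∧ StrictMono c ∧
    ∀ i j, P i j = 1 → A (r i) (c j) = 1

/-- `A` avoids every pattern of the family `F`. -/
def Avoids {k l n m : ℕ} (A : ZeroOneMatrix n m) (F : Set (ZeroOneMatrix k l)) : Prop :=
  ∀ P ∈ F, ¬ P.IsContainedIn A

/-- The reflection of a matrix along the `y`-axis: the order of the columns is reversed. -/
def reflectY {n m : ℕ} (A : ZeroOneMatrix n m) : ZeroOneMatrix n m :=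
  A.submatrix id Fin.rev

open Classical in
/-- The extremal function `Ex(F, n, m)`: the maximum number of 1s in an `n × m` 0--1 matrix that
avoids every pattern of `F`. -/
noncomputable def Ex {k l : ℕ} (F : Set (ZeroOneMatrix k l)) (n m : ℕ) : ℕ :=
  (Finset.univ.filter fun A : ZeroOneMatrix n m => A.Avoids F).sup weight

/-- As soon as some `n × m` matrix avoids `F`, the value `Ex F n m` is an attained maximum. -/
theorem isGreatest_Ex {k l : ℕ} (F : Set (ZeroOneMatrix k l)) (n m : ℕ)
    (h : ∃ A : ZeroOneMatrix n m, A.Avoids F) :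
    IsGreatest {w : ℕ | ∃ A : ZeroOneMatrix n m, A.Avoids F ∧ A.weight = w} (Ex F n m) := by
  classical
  constructor
  · obtain ⟨A₀, hA₀⟩ := h
    obtain ⟨A, hA, hw⟩ := Finset.exists_mem_eq_sup
      (Finset.univ.filter fun A : ZeroOneMatrix n m => A.Avoids F) ⟨A₀, by simpa using hA₀⟩ weight
    refine ⟨A, by simpa using hA, ?_⟩
    rw [← hw, Ex]
  · rintro w ⟨A, hA, rfl⟩
    exact Finset.le_sup (f := weight) (by simpa using hA)

/-- The pattern `W`. -/
def W : ZeroOneMatrix 4 5 :=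
  !![1, 0, 0, 0, 0;
     0, 0, 0, 0, 1;
     0, 0, 1, 0, 0;
     0, 1, 0, 1, 0]

/-- The reflection `W'` of `W` along the `y`-axis. -/
def W' : ZeroOneMatrix 4 5 := W.reflectY

theorem W'_eq : W' =
    !![0, 0, 0, 0, 1;
       1, 0, 0, 0, 0;
       0, 0, 1, 0, 0;
       0, 1, 0, 1, 0] := by
  decide

/-- The zero matrix avoids `W` and `W'`, so `Ex {W, W'} n m` is an attained maximum. -/
theorem zero_avoids (n m : ℕ) : (0 : ZeroOneMatrix n m).Avoids {W, W'} := by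
  rintro P (rfl | rfl) ⟨r, c, -, -, h⟩
  · simpa using h 0 0 (by decide)
  · simpa using h 0 4 (by decide)

end ZeroOneMatrix

namespace InverseAckermann

/-- The version of Ackermann's function with `a 1 j = 2 ^ j` for `j ≥ 1`, `a i 1 = 2` for `i ≥ 2`,
and `a i j = w * a (i - 1) w`, where `w = a i (j - 1)`, for `i, j ≥ 2`.
Only indices `i, j ≥ 1` are meaningful; the value is set to `0` elsewhere. -/
def a : ℕ → ℕ → ℕ
  | 0, _ => 0
  | _ + 1, 0 => 0
  | 1, j + 1 => 2 ^ (j + 1)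
  | _ + 2, 1 => 2
  | i + 2, j + 2 => a (i + 2) (j + 1) * a (i + 1) (a (i + 2) (j + 1))
termination_by i j => (i, j)

/-- `α(n, m) = min {i ≥ 1 : a i j ≥ m}`, where `j = max {3, ⌈n / m⌉}`, for `n, m ≥ 1`. -/
noncomputable def α (n m : ℕ) : ℕ :=
  sInf {i : ℕ | 1 ≤ i ∧ m ≤ a i (max 3 ⌈(n : ℚ) / (m : ℚ)⌉₊)}

theorem a_pos (i j : ℕ) : 0 < a (i + 1) (j + 1) := by
  induction i generalizing j with
  | zero => simp [a]
  | succ i ih =>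
    induction j with
    | zero => simp [a]
    | succ j jh =>
      rw [a]
      obtain ⟨w, hw⟩ := Nat.exists_eq_succ_of_ne_zero jh.ne'
      exact Nat.mul_pos jh (by rw [hw]; exact ih w)

theorem a_two (i : ℕ) : a (i + 1) 2 = 2 ^ (i + 2) := by
  induction i with
  | zero => simp [a]
  | succ i ih => rw [a, a, ih]; ring

theorem a_le_succ (i j : ℕ) : a (i + 1) (j + 1) ≤ a (i + 1) (j + 2) := by
  cases i with
  | zero => simp only [a, zero_add]; exact Nat.pow_le_pow_right (by norm_num) (by omega)
  | succ i =>
    rw [a.eq_5]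
    obtain ⟨w, hw⟩ := Nat.exists_eq_succ_of_ne_zero (a_pos (i + 1) j).ne'
    exact Nat.le_mul_of_pos_right _ (by rw [hw]; exact a_pos i w)

theorem two_pow_le_a (i j : ℕ) : 2 ^ (i + 2) ≤ a (i + 1) (j + 2) := by
  induction j with
  | zero => exact (a_two i).ge
  | succ j ih => exact ih.trans (a_le_succ i (j + 1))

/-- The set in the definition of `α` is non-empty, so that its minimum exists. -/
theorem exists_le_a (m j : ℕ) (hj : 2 ≤ j) : ∃ i : ℕ, 1 ≤ i ∧ m ≤ a i j := by
  obtain ⟨k, rfl⟩ := Nat.exists_eq_add_of_le' hj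
  refine ⟨m + 1, by omega, le_trans ?_ (two_pow_le_a m k)⟩
  exact (Nat.lt_two_pow_self).le.trans (Nat.pow_le_pow_right (by norm_num) (by omega))

end InverseAckermann

/-! Fix a 1 in the topmost non-empty row. With it as corner, a hook strictly below and to the right
completes `W`; mirrored, the same holds on the left for `W'`. Apart from one row and one column, the
weight is thus that of two hook-free parts, each with at most 2nα + O(n+m) points. For a hook-free
set, cut wb columns into b blocks of width w (`Bound.mul`). Rows inside one block are counted
blockwise; the others are contracted to b columns, which loses at most 2 points per row and 6 per
column. The coefficient per row thus grows by 2 only in the contracted problem. Choosing w and b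
along the recursion for `a` gives coefficient 2i + O(1) up to width about `a i j`, at an additive
cost O(j) per column (`bound_two_pow`). -/

namespace PointSet

/-! ### Hook-free sets and linear bounds -/

/-- A set of points `(row, column)` is hook-free if, viewed as a 0--1 matrix, it avoids the
pattern with rows `0001`, `0100`, `1010`. -/
def HookFree (S : Finset (ℕ × ℕ)) : Prop :=
  ∀ ⦃r₁ r₂ r₃ c₁ c₂ c₃ c₄ : ℕ⦄, r₁ < r₂ → r₂ < r₃ → c₁ < c₂ → c₂ < c₃ → c₃ < c₄ →
    (r₁, c₄) ∈ S → (r₂, c₂) ∈ S → (r₃, c₁) ∈ S → (r₃, c₃) ∈ S → False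

/-- The set of non-empty rows. -/
def rows (S : Finset (ℕ × ℕ)) : Finset ℕ := S.image Prod.fst

theorem HookFree.mono {S T : Finset (ℕ × ℕ)} (hS : HookFree S) (h : T ⊆ S) : HookFree T :=
  fun _ _ _ _ _ _ _ h₁ h₂ h₃ h₄ h₅ m₁ m₂ m₃ m₄ =>
    hS h₁ h₂ h₃ h₄ h₅ (h m₁) (h m₂) (h m₃) (h m₄)

/-- Merging consecutive columns into blocks of width `w`. -/
def contract (w : ℕ) (S : Finset (ℕ × ℕ)) : Finset (ℕ × ℕ) :=
  S.image fun p => (p.1, p.2 / w)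

theorem lt_of_div_lt_div {a b w : ℕ} (h : a / w < b / w) : a < b := by
  by_contra hab
  exact absurd (Nat.div_le_div_right (c := w) (not_lt.mp hab)) (not_le.mpr h)

/-- Each column of the hook holds a single 1, so its points lift independently, and points in
distinct blocks keep their order. -/
theorem HookFree.contract {S : Finset (ℕ × ℕ)} (hS : HookFree S) (w : ℕ) :
    HookFree (contract w S) := by
  intro r₁ r₂ r₃ c₁ c₂ c₃ c₄ h₁ h₂ h₃ h₄ h₅ m₁ m₂ m₃ m₄
  simp only [PointSet.contract, Finset.mem_image, Prod.mk.injEq, Prod.exists] at m₁ m₂ m₃ m₄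
  obtain ⟨_, d₄, m₁, rfl, rfl⟩ := m₁
  obtain ⟨_, d₂, m₂, rfl, rfl⟩ := m₂
  obtain ⟨_, d₁, m₃, rfl, rfl⟩ := m₃
  obtain ⟨_, d₃, m₄, rfl, rfl⟩ := m₄
  exact hS h₁ h₂ (lt_of_div_lt_div h₃) (lt_of_div_lt_div h₄) (lt_of_div_lt_div h₅) m₁ m₂ m₃ m₄

theorem rows_contract (w : ℕ) (S : Finset (ℕ × ℕ)) : rows (contract w S) = rows S := by
  simp [rows, contract, Finset.image_image, Function.comp_def]

theorem exists_three_lt {R : Finset ℕ} (h : 2 < R.card) :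
    ∃ a ∈ R, ∃ b ∈ R, ∃ c ∈ R, a < b ∧ b < c := by
  let f := R.orderEmbOfFin rfl
  refine ⟨f ⟨0, by omega⟩, R.orderEmbOfFin_mem rfl _, f ⟨1, by omega⟩, R.orderEmbOfFin_mem rfl _,
    f ⟨2, by omega⟩, R.orderEmbOfFin_mem rfl _, ?_, ?_⟩ <;>
  exact f.strictMono (by simp [Fin.lt_def])

theorem card_le_two_mul_of_no_three {E : Finset (ℕ × ℕ)} {K : Finset ℕ}
    (hK : ∀ p ∈ E, p.2 ∈ K)
    (h : ∀ ⦃r₁ r₂ r₃ c : ℕ⦄, r₁ < r₂ → r₂ < r₃ → (r₁, c) ∈ E → (r₂, c) ∈ E → (r₃, c) ∈ E → False) :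
    E.card ≤ 2 * K.card := by
  refine Finset.card_le_mul_card_image_of_maps_to (f := Prod.snd) hK 2 fun c _ => ?_
  by_contra hc
  have hinj : Set.InjOn Prod.fst (E.filter fun p => p.2 = c : Set (ℕ × ℕ)) := by
    rintro ⟨r, d⟩ hp ⟨r', d'⟩ hp' hrr
    simp at hp hp' hrr
    simp [hrr, hp.2, hp'.2]
  obtain ⟨r₁, m₁, r₂, m₂, r₃, m₃, h₁, h₂⟩ := exists_three_lt
    (R := (E.filter fun p => p.2 = c).image Prod.fst)
    (by rw [Finset.card_image_of_injOn (by simpa using hinj)]; omega)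
  simp at m₁ m₂ m₃
  exact h h₁ h₂ m₁ m₂ m₃

theorem div_eq_mem_Ico {c m x : ℕ} (hm : 0 < m) (h : c / m = x) :
    c ∈ Finset.Ico (x * m) ((x + 1) * m) := by
  subst h
  simp only [Finset.mem_Ico]
  exact ⟨Nat.div_mul_le_self c m, Nat.lt_mul_of_div_lt (Nat.lt_succ_self _) hm⟩

theorem card_Ico_mul (x m : ℕ) : (Finset.Ico (x * m) ((x + 1) * m)).card = m := by
  simp [add_mul]

/-- A linear bound on the size of hook-free sets inside an aligned range of `m` columns. -/
def Bound (m c D : ℕ) : Prop :=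
  ∀ (x : ℕ) (S : Finset (ℕ × ℕ)), HookFree S → (∀ p ∈ S, p.2 / m = x) →
    S.card ≤ c * (rows S).card + D

theorem Bound.mono {m c D c' D' : ℕ} (h : Bound m c D) (hc : c ≤ c') (hD : D ≤ D') :
    Bound m c' D' := fun x S hS hx =>
  (h x S hS hx).trans (add_le_add (Nat.mul_le_mul_right _ hc) hD)

theorem bound_trivial {m : ℕ} (hm : 0 < m) : Bound m m 0 := by
  intro x S _ hx
  refine Finset.card_le_mul_card_image (f := Prod.fst) S m fun r _ => ?_
  rw [← card_Ico_mul x m]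
  refine Finset.card_le_card_of_injOn Prod.snd
    (fun p hp => div_eq_mem_Ico hm (hx p (Finset.mem_filter.mp hp).1)) ?_
  rintro ⟨r, d⟩ hp ⟨r', d'⟩ hp' hrr
  simp at hp hp' hrr
  simp [hrr, hp.2, hp'.2]

/-! ### Decomposition into blocks of columns -/

section Blocks

variable (w : ℕ) (S : Finset (ℕ × ℕ))

/-- The row of `p` has a point in a block to the left of that of `p`. -/
def HasLeft (p : ℕ × ℕ) : Prop := ∃ c, (p.1, c) ∈ S ∧ c / w < p.2 / w

/-- The row of `p` has a point in a block to the right of that of `p`. -/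
def HasRight (p : ℕ × ℕ) : Prop := ∃ c, (p.1, c) ∈ S ∧ p.2 / w < c / w

/-- `p` is not the leftmost point of its row in its block. -/
def Preceded (p : ℕ × ℕ) : Prop := ∃ c, (p.1, c) ∈ S ∧ c < p.2 ∧ c / w = p.2 / w

/-- `p` is not the rightmost point of its row in its block. -/
def Followed (p : ℕ × ℕ) : Prop := ∃ c, (p.1, c) ∈ S ∧ p.2 < c ∧ c / w = p.2 / w

open Classical in
/-- The points in rows that meet only one block. -/
noncomputable def localPart : Finset (ℕ × ℕ) :=
  S.filter fun p => ¬ HasLeft w S p ∧ ¬ HasRight w S p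

open Classical in
/-- The points in rows that meet at least two blocks. -/
noncomputable def globalPart : Finset (ℕ × ℕ) :=
  S.filter fun p => ¬ (¬ HasLeft w S p ∧ ¬ HasRight w S p)

variable {w S}

theorem mem_localPart {p : ℕ × ℕ} :
    p ∈ localPart w S ↔ p ∈ S ∧ ¬ HasLeft w S p ∧ ¬ HasRight w S p := by
  classical simp [localPart]

theorem mem_globalPart {p : ℕ × ℕ} :
    p ∈ globalPart w S ↔ p ∈ S ∧ (HasLeft w S p ∨ HasRight w S p) := by
  classical
  rw [globalPart, Finset.mem_filter]
  tauto

theorem card_localPart_add_card_globalPart :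
    (localPart w S).card + (globalPart w S).card = S.card := by
  classical exact Finset.card_filter_add_card_filter_not _

theorem div_eq_of_mem_localPart {r c d : ℕ} (hc : (r, c) ∈ localPart w S) (hd : (r, d) ∈ S) :
    d / w = c / w := by
  obtain ⟨_, hl, hr⟩ := mem_localPart.mp hc
  by_contra hne
  rcases lt_or_gt_of_ne hne with h | h
  exacts [hl ⟨d, hd, h⟩, hr ⟨d, hd, h⟩]

theorem disjoint_rows_localPart_globalPart :
    Disjoint (rows (localPart w S)) (rows (globalPart w S)) := by
  rw [Finset.disjoint_left]
  intro r hr hr'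
  simp only [rows, Finset.mem_image, Prod.exists, exists_and_right, exists_eq_right] at hr hr'
  obtain ⟨c, hc⟩ := hr
  obtain ⟨d, hd⟩ := hr'
  obtain ⟨hdS, ⟨e, he, hlt⟩ | ⟨e, he, hlt⟩⟩ := mem_globalPart.mp hd <;>
  · have h₁ := div_eq_of_mem_localPart hc hdS
    have h₂ := div_eq_of_mem_localPart hc he
    simp only at hlt
    omega

theorem card_rows_localPart_add_card_rows_globalPart_le :
    (rows (localPart w S)).card + (rows (globalPart w S)).card ≤ (rows S).card := by
  classical
  rw [← Finset.card_union_of_disjoint disjoint_rows_localPart_globalPart]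
  refine Finset.card_le_card (Finset.union_subset ?_ ?_) <;>
  exact Finset.image_subset_image (Finset.filter_subset _ _)

/-- Different blocks have disjoint sets of local rows, so only the additive term is paid b times. -/
theorem card_localPart_le {b c D x : ℕ} (hb : 0 < b) (hB : Bound w c D) (hS : HookFree S)
    (hx : ∀ p ∈ S, p.2 / (w * b) = x) :
    (localPart w S).card ≤ c * (rows (localPart w S)).card + b * D := by
  classical
  set K := Finset.Ico (x * b) ((x + 1) * b) with hK
  have hsub : localPart w S ⊆ S := Finset.filter_subset _ _
  have hmaps : ∀ p ∈ localPart w S, p.2 / w ∈ K := fun p hp =>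
    div_eq_mem_Ico hb (by rw [Nat.div_div_eq_div_mul]; exact hx p (hsub hp))
  let B : ℕ → Finset (ℕ × ℕ) := fun q => (localPart w S).filter fun p => p.2 / w = q
  have hrows : ∑ q ∈ K, (rows (B q)).card ≤ (rows (localPart w S)).card := by
    rw [← Finset.card_biUnion]
    · refine Finset.card_le_card (Finset.biUnion_subset.mpr fun q _ => ?_)
      exact Finset.image_subset_image (Finset.filter_subset _ _)
    · intro q _ q' _ hne
      rw [Function.onFun, Finset.disjoint_left]
      intro r hr hr'
      simp only [B, rows, Finset.mem_image, Finset.mem_filter, Prod.exists, exists_and_right,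
        exists_eq_right] at hr hr'
      obtain ⟨d, hd, rfl⟩ := hr
      obtain ⟨d', hd', rfl⟩ := hr'
      exact hne (div_eq_of_mem_localPart hd (hsub hd')).symm
  calc (localPart w S).card = ∑ q ∈ K, (B q).card :=
        Finset.card_eq_sum_card_fiberwise hmaps
    _ ≤ ∑ q ∈ K, (c * (rows (B q)).card + D) := by
        refine Finset.sum_le_sum fun q _ => hB q _ ?_ fun p hp => (Finset.mem_filter.mp hp).2
        exact hS.mono ((Finset.filter_subset _ _).trans hsub)
    _ = c * ∑ q ∈ K, (rows (B q)).card + b * D := by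
        rw [Finset.sum_add_distrib, Finset.mul_sum, Finset.sum_const, hK, card_Ico_mul,
          smul_eq_mul]
    _ ≤ _ := by gcongr

-- The leftmost points of a row in its blocks map injectively to the contraction; the rest are
-- preceded.
open Classical in
theorem card_globalPart_le :
    (globalPart w S).card ≤ (contract w (globalPart w S)).card +
      ((globalPart w S).filter (Preceded w S)).card := by
  have h := Finset.card_filter_add_card_filter_not (s := globalPart w S) (Preceded w S ·)
  rw [← h, add_comm]
  refine Nat.add_le_add_right ?_ _
  refine Finset.card_le_card_of_injOn (fun p => (p.1, p.2 / w))
    (fun p hp => Finset.mem_image_of_mem (fun p : ℕ × ℕ => (p.1, p.2 / w))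
      (Finset.mem_filter.mp (Finset.mem_coe.mp hp)).1) ?_
  rintro ⟨r, c⟩ hp ⟨r', c'⟩ hp' heq
  simp only [Finset.coe_filter, Set.mem_ofPred_eq, mem_globalPart] at hp hp'
  simp only [Prod.mk.injEq] at heq
  obtain ⟨rfl, heq⟩ := heq
  rcases lt_trichotomy c c' with h | rfl | h
  · exact absurd ⟨c, hp.1.1, h, heq⟩ hp'.2
  · rfl
  · exact absurd ⟨c', hp'.1.1, h, heq.symm⟩ hp.2

theorem card_filter_le_two_mul {M x : ℕ} (hM : 0 < M) (hx : ∀ p ∈ S, p.2 / M = x)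
    {Q : ℕ × ℕ → Prop} [DecidablePred Q]
    (h : ∀ ⦃r₁ r₂ r₃ c : ℕ⦄, r₁ < r₂ → r₂ < r₃ → (r₁, c) ∈ S → (r₂, c) ∈ S → (r₃, c) ∈ S →
      Q (r₁, c) → Q (r₂, c) → Q (r₃, c) → False) :
    (S.filter Q).card ≤ 2 * M := by
  have := card_le_two_mul_of_no_three (E := S.filter Q)
    (fun p hp => div_eq_mem_Ico hM (hx p (Finset.mem_filter.mp hp).1)) (by
      intro r₁ r₂ r₃ c h₁ h₂ m₁ m₂ m₃
      simp only [Finset.mem_filter] at m₁ m₂ m₃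
      exact h h₁ h₂ m₁.1 m₂.1 m₃.1 m₁.2 m₂.2 m₃.2)
  rwa [card_Ico_mul] at this

-- Of three such points in one column, the middle one is the hook's second-row point; the bottom row
-- supplies its neighbours in the block, the top row a point in a later block.
open Classical in
theorem card_preceded_followed_hasRight_le {M x : ℕ} (hM : 0 < M) (hS : HookFree S)
    (hx : ∀ p ∈ S, p.2 / M = x) :
    (S.filter fun p => Preceded w S p ∧ Followed w S p ∧ HasRight w S p).card ≤ 2 * M := by
  refine card_filter_le_two_mul hM hx ?_
  rintro r₁ r₂ r₃ c h₁ h₂ - m₂ - ⟨-, -, d, hd, hcd⟩ - ⟨⟨e, he, hec, -⟩, ⟨f, hf, hcf, hfw⟩, -⟩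
  simp only at hd hcd he hec hf hcf hfw
  exact hS h₁ h₂ hec hcf (lt_of_div_lt_div (w := w) (by omega)) hd m₂ he hf

-- Here the bottom point is the right one of the hook's last row: its row has a point in an earlier
-- block, the middle row a preceding point, the top row a following point.
open Classical in
theorem card_preceded_followed_hasLeft_le {M x : ℕ} (hM : 0 < M) (hS : HookFree S)
    (hx : ∀ p ∈ S, p.2 / M = x) :
    (S.filter fun p => Preceded w S p ∧ Followed w S p ∧ HasLeft w S p).card ≤ 2 * M := by
  refine card_filter_le_two_mul hM hx ?_
  rintro r₁ r₂ r₃ c h₁ h₂ - - m₃ ⟨-, ⟨d, hd, hcd, -⟩, -⟩ ⟨⟨e, he, hec, hew⟩, -⟩ ⟨-, -, f, hf, hfc⟩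
  simp only at hd hcd he hec hew hf hfc
  exact hS h₁ h₂ (lt_of_div_lt_div (w := w) (by omega)) hec hcd hd he hf m₃

-- As in the previous case, except that the top row supplies a point in a later block.
open Classical in
theorem card_preceded_hasLeft_hasRight_le {M x : ℕ} (hM : 0 < M) (hS : HookFree S)
    (hx : ∀ p ∈ S, p.2 / M = x) :
    (S.filter fun p => Preceded w S p ∧ HasLeft w S p ∧ HasRight w S p).card ≤ 2 * M := by
  refine card_filter_le_two_mul hM hx ?_
  rintro r₁ r₂ r₃ c h₁ h₂ - - m₃ ⟨-, -, d, hd, hcd⟩ ⟨⟨e, he, hec, hew⟩, -⟩ ⟨-, ⟨f, hf, hfc⟩, -⟩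
  simp only at hd hcd he hec hew hf hfc
  exact hS h₁ h₂ (lt_of_div_lt_div (w := w) (by omega)) hec (lt_of_div_lt_div hcd) hd he hf m₃

theorem eq_of_not_followed {r c d : ℕ} (hc : (r, c) ∈ S) (hd : (r, d) ∈ S) (h : c / w = d / w)
    (hc' : ¬ Followed w S (r, c)) (hd' : ¬ Followed w S (r, d)) : c = d := by
  rcases lt_trichotomy c d with hlt | rfl | hlt
  · exact absurd ⟨d, hd, hlt, h.symm⟩ hc'
  · rfl
  · exact absurd ⟨c, hc, hlt, h⟩ hd'

-- Such a point is the last of its row.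
open Classical in
theorem card_not_followed_not_hasRight_le :
    ((globalPart w S).filter fun p => ¬ Followed w S p ∧ ¬ HasRight w S p).card ≤
      (rows (globalPart w S)).card := by
  refine Finset.card_le_card_of_injOn Prod.fst
    (fun p hp => Finset.mem_image_of_mem Prod.fst (Finset.mem_filter.mp hp).1) ?_
  rintro ⟨r, c⟩ hp ⟨r', d⟩ hp' heq
  simp only [Finset.coe_filter, Set.mem_ofPred_eq, mem_globalPart] at hp hp'
  obtain rfl : r = r' := heq
  have h₁ : ¬ c / w < d / w := fun h => hp.2.2 ⟨d, hp'.1.1, h⟩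
  have h₂ : ¬ d / w < c / w := fun h => hp'.2.2 ⟨c, hp.1.1, h⟩
  rw [eq_of_not_followed hp.1.1 hp'.1.1 (by omega) hp.2.1 hp'.2.1]

-- Such a point is the last of its row within the row's first block.
open Classical in
theorem card_not_followed_not_hasLeft_le :
    ((globalPart w S).filter fun p => ¬ Followed w S p ∧ ¬ HasLeft w S p).card ≤
      (rows (globalPart w S)).card := by
  refine Finset.card_le_card_of_injOn Prod.fst
    (fun p hp => Finset.mem_image_of_mem Prod.fst (Finset.mem_filter.mp hp).1) ?_
  rintro ⟨r, c⟩ hp ⟨r', d⟩ hp' heq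
  simp only [Finset.coe_filter, Set.mem_ofPred_eq, mem_globalPart] at hp hp'
  obtain rfl : r = r' := heq
  have h₁ : ¬ c / w < d / w := fun h => hp'.2.2 ⟨c, hp.1.1, h⟩
  have h₂ : ¬ d / w < c / w := fun h => hp.2.2 ⟨d, hp'.1.1, h⟩
  rw [eq_of_not_followed hp.1.1 hp'.1.1 (by omega) hp.2.1 hp'.2.1]

-- Three types of points occur at most twice per column, giving 6M. What escapes them is the last
-- point of its row in the row's first or last block, at most 2 per row.
open Classical in
theorem card_preceded_le {M x : ℕ} (hM : 0 < M) (hS : HookFree S)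
    (hx : ∀ p ∈ S, p.2 / M = x) :
    ((globalPart w S).filter (Preceded w S)).card ≤
      2 * (rows (globalPart w S)).card + 6 * M := by
  have hsub : (globalPart w S).filter (Preceded w S) ⊆
      (((S.filter fun p => Preceded w S p ∧ Followed w S p ∧ HasRight w S p) ∪
        (S.filter fun p => Preceded w S p ∧ Followed w S p ∧ HasLeft w S p)) ∪
        (S.filter fun p => Preceded w S p ∧ HasLeft w S p ∧ HasRight w S p)) ∪
      (((globalPart w S).filter fun p => ¬ Followed w S p ∧ ¬ HasRight w S p) ∪
        ((globalPart w S).filter fun p => ¬ Followed w S p ∧ ¬ HasLeft w S p)) := by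
    intro p
    simp only [Finset.mem_union, Finset.mem_filter, mem_globalPart]
    tauto
  have h₀ := Finset.card_le_card hsub
  have h₁ := card_preceded_followed_hasRight_le (w := w) hM hS hx
  have h₂ := card_preceded_followed_hasLeft_le (w := w) hM hS hx
  have h₃ := card_preceded_hasLeft_hasRight_le (w := w) hM hS hx
  have h₄ := card_not_followed_not_hasRight_le (w := w) (S := S)
  have h₅ := card_not_followed_not_hasLeft_le (w := w) (S := S)
  refine h₀.trans ((Finset.card_union_le _ _).trans ?_)
  grw [Finset.card_union_le, Finset.card_union_le, Finset.card_union_le, h₁, h₂, h₃, h₄, h₅]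
  omega

/-- Splitting `w * b` columns into `b` blocks of width `w`. -/
theorem Bound.mul {b c c' D D' : ℕ} (hw : 0 < w) (hb : 0 < b) (h : Bound w c D)
    (h' : Bound b c' D') (hc : c' + 2 ≤ c) : Bound (w * b) c (b * D + D' + 6 * (w * b)) := by
  classical
  intro x S hS hx
  have hsub : globalPart w S ⊆ S := Finset.filter_subset _ _
  have h₁ := card_localPart_le hb h hS hx
  have h₂ := h' x (contract w (globalPart w S)) ((hS.mono hsub).contract w) (by
    intro p hp
    obtain ⟨q, hq, rfl⟩ := Finset.mem_image.mp hp
    rw [Nat.div_div_eq_div_mul]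
    exact hx q (hsub hq))
  rw [rows_contract] at h₂
  have h₃ := card_globalPart_le (w := w) (S := S)
  have h₄ := card_preceded_le (w := w) (Nat.mul_pos hw hb) hS hx
  -- Local rows cost c each and global rows c' + 2 ≤ c; no row is both.
  have h₅ := Nat.mul_le_mul_left c
    (card_rows_localPart_add_card_rows_globalPart_le (w := w) (S := S))
  have h₆ := Nat.mul_le_mul_right (rows (globalPart w S)).card hc
  rw [← card_localPart_add_card_globalPart (w := w)]
  rw [mul_add] at h₅
  rw [add_mul] at h₆
  omega

end Blocks

end PointSet

/-! ### Solving the recursion with the Ackermann-type function -/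

namespace InverseAckermann

open PointSet

theorem exists_a_eq_two_pow (i j : ℕ) : ∃ l, a (i + 1) (j + 1) = 2 ^ l := by
  induction i generalizing j with
  | zero => exact ⟨j + 1, by simp [a]⟩
  | succ i ih =>
    induction j with
    | zero => exact ⟨1, by simp [a]⟩
    | succ j jh =>
      obtain ⟨l, hl⟩ := jh
      obtain ⟨v, hv⟩ := Nat.exists_eq_succ_of_ne_zero (a_pos (i + 1) j).ne'
      obtain ⟨l', hl'⟩ := ih v
      refine ⟨l + l', ?_⟩
      rw [a.eq_5, hv, hl', ← hv, hl, pow_add]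

theorem bound_of_two_pow_le_eight {k c D : ℕ} (hk : 2 ^ k ≤ 8) (hc : 8 ≤ c) : Bound (2 ^ k) c D :=
  (bound_trivial (by positivity)).mono (hk.trans hc) (Nat.zero_le _)

/-- The slack factor 4 closes the induction: for w = 4 · 2^l, the contracted problem's additive term
8 · 2^l · b is only 2wb, and with the 6wb lost in contraction it makes exactly one increment 8wb in
j. -/
theorem bound_two_pow (i j k : ℕ) (hk : 2 ^ k ≤ 4 * a (i + 1) (j + 1)) :
    Bound (2 ^ k) (2 * (i + 1) + 8) (8 * (j + 1) * 2 ^ k) := by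
  induction i generalizing j k with
  | zero =>
    induction j generalizing k with
    | zero => exact bound_of_two_pow_le_eight (by simpa [a] using hk) (by omega)
    | succ j jh =>
      have hcoef : 8 * (j + 1) * 2 ^ k ≤ 8 * (j + 1 + 1) * 2 ^ k := by gcongr; omega
      rcases k with _ | k
      · exact bound_of_two_pow_le_eight (by norm_num) (by omega)
      · have hk' : 2 ^ k ≤ 4 * a 1 (j + 1) := by
          simp only [a, zero_add, pow_succ] at hk ⊢
          omega
        refine ((jh k hk').mul (by positivity) two_pos (bound_trivial two_pos)
          (by omega)).mono le_rfl ?_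
        rw [pow_succ]
        nlinarith [Nat.zero_le (2 ^ k)]
  | succ i ih =>
    induction j generalizing k with
    | zero => exact bound_of_two_pow_le_eight (by simpa [a] using hk) (by omega)
    | succ j jh =>
      obtain ⟨l, hl⟩ := exists_a_eq_two_pow (i + 1) j
      by_cases hk' : 2 ^ k ≤ 4 * a (i + 1 + 1) (j + 1)
      · exact (jh k hk').mono le_rfl (by gcongr; omega)
      obtain ⟨v, hv⟩ := Nat.exists_eq_succ_of_ne_zero (a_pos (i + 1) j).ne'
      have hlk : l + 2 < k := by
        rw [hl, not_le, show 4 * 2 ^ l = 2 ^ (l + 2) by ring] at hk'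
        exact (Nat.pow_lt_pow_iff_right (by norm_num)).mp hk'
      obtain ⟨t, rfl⟩ := Nat.exists_eq_add_of_lt hlk
      have hw := jh (l + 2) (by rw [hl, pow_add]; omega)
      have hb := ih v (t + 1) (by
        have hpos : 0 < 4 * 2 ^ l := by positivity
        rw [a.eq_5, hl, ← mul_assoc, show l + 2 + t + 1 = (l + 2) + (t + 1) by ring, pow_add,
          show 2 ^ (l + 2) = 4 * 2 ^ l by ring, ← hl, hv] at hk
        rw [← hl, hv] at hpos
        exact (Nat.le_of_mul_le_mul_left hk hpos).trans (Nat.le_mul_of_pos_left _ (by norm_num)))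
      have hv' : v + 1 = 2 ^ l := by rw [← hl, hv]
      have := hw.mul (by positivity) (by positivity) hb (by omega)
      rw [← pow_add] at this
      refine this.mono le_rfl ?_
      rw [hv', show l + 2 + (t + 1) = l + 2 + t + 1 by ring]
      have h₁ : 2 ^ (l + 2 + t + 1) = 8 * (2 ^ l * 2 ^ t) := by ring
      have h₂ : 2 ^ (t + 1) * (8 * (j + 1) * 2 ^ (l + 2)) = 64 * (j + 1) * (2 ^ l * 2 ^ t) := by ring
      have h₃ : 8 * 2 ^ l * 2 ^ (t + 1) = 16 * (2 ^ l * 2 ^ t) := by ring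
      rw [h₁, h₂, h₃]
      nlinarith [Nat.zero_le (2 ^ l * 2 ^ t)]

theorem one_le_alpha_and_le (n m : ℕ) :
    1 ≤ α n m ∧ m ≤ a (α n m) (max 3 ⌈(n : ℚ) / (m : ℚ)⌉₊) :=
  Nat.sInf_mem (s := {i : ℕ | 1 ≤ i ∧ m ≤ a i (max 3 ⌈(n : ℚ) / (m : ℚ)⌉₊)})
    (exists_le_a m _ (le_max_of_le_left (by norm_num)))

/-- The additive cost, of order jm, stays linear for the j used in `α`. -/
theorem max_ceil_mul_le {n m : ℕ} (hm : 1 ≤ m) :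
    max 3 ⌈(n : ℚ) / (m : ℚ)⌉₊ * m ≤ n + 4 * m := by
  have hm' : (0 : ℚ) < m := by exact_mod_cast hm
  rcases max_cases 3 ⌈(n : ℚ) / (m : ℚ)⌉₊ with ⟨h, -⟩ | ⟨h, -⟩ <;> rw [h]
  · omega
  · have h₁ := (Nat.ceil_lt_add_one (show 0 ≤ (n : ℚ) / m by positivity)).le
    have h₂ : (⌈(n : ℚ) / (m : ℚ)⌉₊ : ℚ) * m ≤ n + m := by
      calc (⌈(n : ℚ) / (m : ℚ)⌉₊ : ℚ) * m ≤ ((n : ℚ) / m + 1) * m := by gcongr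
        _ = n + m := by field_simp
    have h₃ : ⌈(n : ℚ) / (m : ℚ)⌉₊ * m ≤ n + m := by exact_mod_cast h₂
    omega

end InverseAckermann

/-! ### The bound for hook-free sets -/

namespace PointSet

open InverseAckermann

theorem HookFree.card_le {n m : ℕ} (hm : 1 ≤ m) {S : Finset (ℕ × ℕ)} (hS : HookFree S)
    (hn : ∀ p ∈ S, p.1 < n) (hSm : ∀ p ∈ S, p.2 < m) :
    S.card ≤ 2 * n * α n m + 24 * n + 64 * m := by
  obtain ⟨h₁, h₂⟩ := one_le_alpha_and_le n m
  have h₃ := max_ceil_mul_le (n := n) hm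
  obtain ⟨i, hi⟩ := Nat.exists_eq_add_of_le' h₁
  have hj3 : 1 ≤ max 3 ⌈(n : ℚ) / (m : ℚ)⌉₊ := le_max_of_le_left (by norm_num)
  obtain ⟨j, hj⟩ := Nat.exists_eq_add_of_le' hj3
  rw [hi, hj] at h₂
  rw [hj] at h₃
  rw [hi]
  obtain ⟨l, hl⟩ := exists_a_eq_two_pow i j
  have hk : 2 ^ Nat.clog 2 m ≤ 4 * a (i + 1) (j + 1) := by
    have hle : Nat.clog 2 m ≤ l := Nat.clog_le_of_le_pow (hl ▸ h₂)
    rw [hl]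
    exact (Nat.pow_le_pow_right two_pos hle).trans (Nat.le_mul_of_pos_left _ (by norm_num))
  -- Rounding m up to a power of 2 at most doubles it: the additive term is at most 16jm ≤ 16n +
  -- 64m.
  have hle : 2 ^ Nat.clog 2 m ≤ 2 * m := by
    rcases Nat.lt_or_ge 1 m with h | h
    · have hlt := Nat.pow_pred_clog_lt_self (b := 2) (by norm_num) h
      have hpos : 0 < Nat.clog 2 m := Nat.clog_pos (by norm_num) h
      obtain ⟨t, ht⟩ := Nat.exists_eq_succ_of_ne_zero hpos.ne'
      rw [ht] at hlt ⊢
      rw [pow_succ]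
      simp only [Nat.pred_succ] at hlt
      omega
    · rw [Nat.clog_of_right_le_one h]
      omega
  have hb := bound_two_pow i j _ hk 0 S hS fun p hp =>
    Nat.div_eq_of_lt ((hSm p hp).trans_le (Nat.le_pow_clog (by norm_num) m))
  have hrows : (rows S).card ≤ n := by
    simpa using Finset.card_le_card (show rows S ⊆ Finset.range n from fun r hr => by
      obtain ⟨p, hp, rfl⟩ := Finset.mem_image.mp hr
      simpa using hn p hp)
  have h₄ := Nat.mul_le_mul_left (2 * (i + 1) + 8) hrows
  have h₅ := Nat.mul_le_mul_left (8 * (j + 1)) hle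
  nlinarith

end PointSet

/-! ### Reduction from `W` and `W'` to hooks -/

namespace ZeroOneMatrix

open InverseAckermann PointSet

/-- The hook is `W` without its first row and column, and the 1 at (r, c) supplies the missing
corner. -/
theorem card_below_right_le {n m : ℕ} (hm : 1 ≤ m) {A : ZeroOneMatrix n m}
    (hA : ¬ W.IsContainedIn A) {r : Fin n} {c : Fin m} (h : A r c = 1) :
    (Finset.univ.filter fun p : Fin n × Fin m => A p.1 p.2 = 1 ∧ r < p.1 ∧ c < p.2).card ≤
      2 * n * α n m + 24 * n + 64 * m := by
  set T := Finset.univ.filter fun p : Fin n × Fin m => A p.1 p.2 = 1 ∧ r < p.1 ∧ c < p.2 with hT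
  let f : Fin n × Fin m → ℕ × ℕ := fun p => (p.1, p.2)
  have hf : Function.Injective f := fun p q hpq => by
    simp only [f, Prod.mk.injEq] at hpq
    exact Prod.ext (Fin.ext hpq.1) (Fin.ext hpq.2)
  rw [← Finset.card_image_of_injective T hf]
  refine HookFree.card_le hm ?_ ?_ ?_
  · intro r₁ r₂ r₃ c₁ c₂ c₃ c₄ h₁ h₂ h₃ h₄ h₅ m₁ m₂ m₃ m₄
    simp only [f, hT, Finset.mem_image, Finset.mem_filter, Finset.mem_univ, true_and,
      Prod.mk.injEq, Prod.exists] at m₁ m₂ m₃ m₄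
    obtain ⟨s₁, d₄, ⟨e₁, hr, -⟩, rfl, rfl⟩ := m₁
    obtain ⟨s₂, d₂, ⟨e₂, -⟩, rfl, rfl⟩ := m₂
    obtain ⟨s₃, d₁, ⟨e₃, -, hc⟩, rfl, rfl⟩ := m₃
    obtain ⟨s₃', d₃, ⟨e₄, -⟩, hs, rfl⟩ := m₄
    obtain rfl : s₃' = s₃ := Fin.ext hs
    refine hA ⟨![r, s₁, s₂, s₃'], ![c, d₁, d₂, d₃, d₄], ?_, ?_, ?_⟩
    · rw [Fin.strictMono_iff_lt_succ]
      intro i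
      fin_cases i
      exacts [hr, h₁, h₂]
    · rw [Fin.strictMono_iff_lt_succ]
      intro i
      fin_cases i
      exacts [hc, h₃, h₄, h₅]
    · intro i j hij
      fin_cases i <;> fin_cases j <;>
        first
        | exact absurd hij (by decide)
        | assumption
  · intro p hp
    obtain ⟨q, -, rfl⟩ := Finset.mem_image.mp hp
    exact q.1.isLt
  · intro p hp
    obtain ⟨q, -, rfl⟩ := Finset.mem_image.mp hp
    exact q.2.isLt

theorem IsContainedIn.reflectY {k l n m : ℕ} {P : ZeroOneMatrix k l} {A : ZeroOneMatrix n m}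
    (h : P.IsContainedIn A.reflectY) : P.reflectY.IsContainedIn A := by
  obtain ⟨r, c, hr, hc, h⟩ := h
  refine ⟨r, fun j => (c j.rev).rev, hr, fun i j hij => ?_, fun i j hij => h i j.rev hij⟩
  exact Fin.rev_lt_rev.mpr (hc (Fin.rev_lt_rev.mpr hij))

theorem card_below_left_le {n m : ℕ} (hm : 1 ≤ m) {A : ZeroOneMatrix n m}
    (hA : ¬ W'.IsContainedIn A) {r : Fin n} {c : Fin m} (h : A r c = 1) :
    (Finset.univ.filter fun p : Fin n × Fin m => A p.1 p.2 = 1 ∧ r < p.1 ∧ p.2 < c).card ≤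
      2 * n * α n m + 24 * n + 64 * m := by
  refine le_trans ?_ (card_below_right_le hm (A := A.reflectY) (fun hW => hA hW.reflectY)
    (r := r) (c := c.rev) (by simpa [ZeroOneMatrix.reflectY] using h))
  refine Finset.card_le_card_of_injOn (fun p => (p.1, p.2.rev)) (fun p hp => ?_)
    (fun p _ q _ hpq => ?_)
  · obtain ⟨h₁, h₂, h₃⟩ := (Finset.mem_filter.mp hp).2
    refine Finset.mem_filter.mpr ⟨Finset.mem_univ _, ?_, h₂, Fin.rev_lt_rev.mpr h₃⟩
    simpa [ZeroOneMatrix.reflectY] using h₁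
  · simp only [Prod.mk.injEq, Fin.rev_inj] at hpq
    exact Prod.ext hpq.1 hpq.2

theorem weight_le_of_avoids {n m : ℕ} (hm : 1 ≤ m) {A : ZeroOneMatrix n m}
    (hA : A.Avoids {W, W'}) : A.weight ≤ 4 * n * α n m + 49 * n + 129 * m := by
  classical
  rcases (Finset.univ.filter fun r : Fin n => ∃ c, A r c = 1).eq_empty_or_nonempty with he | hne
  · have : A.weight = 0 := by
      refine Finset.card_eq_zero.mpr (Finset.filter_eq_empty_iff.mpr fun p _ hp => ?_)
      exact Finset.filter_eq_empty_iff.mp he (Finset.mem_univ p.1) ⟨p.2, hp⟩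
    omega
  obtain ⟨c, hc⟩ := (Finset.mem_filter.mp (Finset.min'_mem _ hne)).2
  set r := Finset.min' _ hne
  have htop : ∀ p : Fin n × Fin m, A p.1 p.2 = 1 → r ≤ p.1 := fun p hp =>
    Finset.min'_le _ _ (Finset.mem_filter.mpr ⟨Finset.mem_univ _, p.2, hp⟩)
  have hR := card_below_right_le hm (hA W (by simp)) hc
  have hL := card_below_left_le hm (hA W' (by simp)) hc
  have hrow : ((Finset.univ : Finset (Fin m)).image fun d => (r, d)).card ≤ m := by
    simpa using Finset.card_image_le (s := (Finset.univ : Finset (Fin m))) (f := fun d => (r, d))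
  have hcol : ((Finset.univ : Finset (Fin n)).image fun s => (s, c)).card ≤ n := by
    simpa using Finset.card_image_le (s := (Finset.univ : Finset (Fin n))) (f := fun s => (s, c))
  have hsub : (Finset.univ.filter fun p : Fin n × Fin m => A p.1 p.2 = 1) ⊆
      ((Finset.univ.image fun d => (r, d)) ∪ (Finset.univ.image fun s => (s, c))) ∪
      ((Finset.univ.filter fun p : Fin n × Fin m => A p.1 p.2 = 1 ∧ r < p.1 ∧ c < p.2) ∪
       (Finset.univ.filter fun p : Fin n × Fin m => A p.1 p.2 = 1 ∧ r < p.1 ∧ p.2 < c)) := by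
    rintro ⟨s, d⟩ hp
    have hp' : A s d = 1 := (Finset.mem_filter.mp hp).2
    have hle := htop (s, d) hp'
    simp only [Finset.mem_union, Finset.mem_image, Finset.mem_filter, Finset.mem_univ, true_and,
      Prod.mk.injEq, exists_eq_right, hp']
    rcases hle.eq_or_lt with h₁ | h₁
    · exact Or.inl (Or.inl h₁)
    · rcases lt_trichotomy c d with h₂ | h₂ | h₂
      exacts [Or.inr (Or.inl ⟨h₁, h₂⟩), Or.inl (Or.inr ⟨s, rfl, h₂⟩), Or.inr (Or.inr ⟨h₁, h₂⟩)]
  refine (Finset.card_le_card hsub).trans ?_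
  grw [Finset.card_union_le, Finset.card_union_le, Finset.card_union_le, hrow, hcol, hR, hL]
  -- Twice the one-sided bound, plus n for the column and m for the row: 49 = 2 · 24 + 1, 129 = 2 ·
  -- 64 + 1.
  exact le_of_eq (by ring)

end ZeroOneMatrix

theorem mainTheorem5 :
    ∃ C : ℝ, ∀ n m : ℕ, 1 ≤ n → 1 ≤ m →
      (ZeroOneMatrix.Ex {ZeroOneMatrix.W, ZeroOneMatrix.W'} n m : ℝ) ≤
        4 * (n : ℝ) * (InverseAckermann.α n m : ℝ) + C * ((n : ℝ) + (m : ℝ)) := by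
  refine ⟨129, fun n m _ hm => ?_⟩
  have h : ZeroOneMatrix.Ex {ZeroOneMatrix.W, ZeroOneMatrix.W'} n m ≤
      4 * n * InverseAckermann.α n m + 129 * (n + m) := by
    refine Finset.sup_le fun A hA => ?_
    have := ZeroOneMatrix.weight_le_of_avoids hm (show A.Avoids _ by simpa using hA)
    omega
  exact_mod_cast h
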